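/- Let $0\le m<n$ be integers, let $K>0$ be real, and let $z_1,\dots,z_m\in\mathbb C$ (the plant zeros) be such that $$B(s)=K\prod_{i=1}^m (s-z_i)=b_0s^n+b_1s^{n-1}+\cdots+b_n$$ has real coefficients (so $b_i=0$ for $i<n-m$). For $p=(p_1,\dots,p_n)\in\mathbb C^n$ let $$H_p(s)=\frac{B(s)}{\prod_{i=1}^n (s-p_i)}$$ be the closed-loop transfer function with poles $p$. Call $H_p$ stable if $\operatorname{Re}p_i<0$ for all $i$, and call it PIR (positive impulse response) if its inverse Laplace transform $h=\mathfrak L^{-1}\{H_p\}$, i.e. the continuous function on $[0,\infty)$ with $\int_0^\infty e^{-st}h(t)\,dt=H_p(s)$ for all $s$ in some right half-plane, satisfies $h(t)\ge 0$ for all $t\ge 0$ (in particular $h$ is real-valued). Put $$\tilde B(s)=\sum_{i=1}^n\frac{b_i}{(i-1)!}\,s^{n-i}.$$ Then there exist poles $p\in\mathbb C^n$ such that $H_p$ is stable and PIR if and only if the polynomial $\tilde B$ has no real non-negative root. -/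

import Mathlib

open Polynomial MeasureTheory

/-- `h`, restricted to `[0, ∞)`, is the inverse (one-sided) Laplace transform of `H`: it is
continuous on `[0, ∞)`, and on some right half-plane its Laplace integral converges absolutely
and equals `H`. By continuity the values of `h` on `[0, ∞)` are uniquely determined by `H`. -/
def IsInverseLaplace (H : ℂ → ℂ) (h : ℝ → ℝ) : Prop :=
  ContinuousOn h (Set.Ici 0) ∧
    ∃ c : ℝ, ∀ s : ℂ, c < s.re →
      IntegrableOn (fun t : ℝ => Complex.exp (-(s * (t : ℂ))) * (h t : ℂ)) (Set.Ioi 0) ∧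
        ∫ t in Set.Ioi (0 : ℝ), Complex.exp (-(s * (t : ℂ))) * (h t : ℂ) = H s

/-- A (strictly proper) transfer function is PIR (positive impulse response) if its inverse
Laplace transform is non-negative on `[0, ∞)`. -/
def IsPIR (H : ℂ → ℂ) : Prop :=
  ∃ h : ℝ → ℝ, IsInverseLaplace H h ∧ ∀ t : ℝ, 0 ≤ t → 0 ≤ h t

/-- The closed-loop transfer function
`H(s) = K ∏ (s - z i) / ∏ (s - p i)` with zeros `z`, poles `p` and gain `K`. -/
noncomputable def closedLoopTransfer {m n : ℕ} (K : ℝ) (z : Fin m → ℂ) (p : Fin n → ℂ) :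
    ℂ → ℂ :=
  fun s => (K : ℂ) * (∏ i, (s - z i)) / ∏ i, (s - p i)

/-- The stable PIR pole placement problem with zeros `z`, gain `K` and `n` closed-loop poles is
feasible: there are `n` poles in the open left half-plane (listed with multiplicity) for which the
closed-loop transfer function is PIR. -/
def StablePIRFeasible {m : ℕ} (n : ℕ) (K : ℝ) (z : Fin m → ℂ) : Prop :=
  ∃ p : Fin n → ℂ, (∀ i, (p i).re < 0) ∧ IsPIR (closedLoopTransfer K z p)

/-- The coefficient `b i` in `B(s) = b 0 * s ^ n + b 1 * s ^ (n - 1) + ⋯ + b n`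
(used for `i ≤ n`). -/
noncomputable def numCoeff (n : ℕ) (B : ℝ[X]) (i : ℕ) : ℝ := B.coeff (n - i)

/-- The transformed numerator polynomial `∑_{i=1}^n b i / (i - 1)! * s ^ (n - i)`. -/
noncomputable def transformedNumerator (n : ℕ) (B : ℝ[X]) : ℝ[X] :=
  ∑ i ∈ Finset.Icc 1 n, C (numCoeff n B i / ((i - 1).factorial : ℝ)) * X ^ (n - i)

/-!
Write `Q` for the impulse response of `B(s) / s ^ n`, where all poles are at the origin
(`impulsePoly`). It is the polynomial `∑ b_i t ^ (i - 1) / (i - 1)!`, so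
`Q(t) = t ^ (n - 1) * B̃(t⁻¹)` for `t ≠ 0`, and the root condition on `B̃` says that `Q` is positive
on `(0, ∞)` and has exact degree `n - 1`.

Necessity (`not_isRoot_transformedNumerator`). Let `h ≥ 0` be the impulse response for stable poles.
The denominator `P` is real because the transfer function is real on the real axis, and since its
roots lie in the left half-plane its coefficients are non-negative. From
`B(s) / s ^ n = (P(s) / s ^ n) * H(s)` and the uniqueness of Laplace transforms, `Q` is a combination
with non-negative coefficients of iterated primitives of `h`; in particular `Q` is bounded below by
`P(0) > 0` times the `n`-fold primitive of `h`. That primitive is positive for `t > 0`, since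
otherwise `h`, and with it the polynomial `Q`, would vanish on an interval. It also grows at least
like `t ^ (n - 1)`, so `Q` has degree `n - 1` and `B̃` does not vanish at `0`.

Sufficiency (`exists_pos_impulsePoly_taylor_nonneg`). Put all poles at `-ε`. The impulse response is
`exp (-ε t)` times that of `B(s - ε) / s ^ n`, a polynomial whose coefficients are close to those of
`Q` and which vanishes at `t = 0` to the same order. As `Q` is positive on `(0, ∞)`, also after
division by its lowest power at `0` and by `t ^ (n - 1)` at infinity, compactness of the time axis
`[0, ∞]`, covered by the charts `t ∈ [0, 1]` and `t⁻¹ ∈ [0, 1]`, gives positivity on `(0, ∞)` for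
small `ε`.
-/

/-! ### One-sided Laplace transforms -/

/-- The one-sided Laplace integral of `f` converges absolutely on the half-plane `c < re s`, where
its value is `F s`. -/
def HasLaplace (c : ℝ) (f : ℝ → ℝ) (F : ℂ → ℂ) : Prop :=
  ∀ s : ℂ, c < s.re →
    IntegrableOn (fun t : ℝ => Complex.exp (-(s * (t : ℂ))) * (f t : ℂ)) (Set.Ioi 0) ∧
      ∫ t in Set.Ioi (0 : ℝ), Complex.exp (-(s * (t : ℂ))) * (f t : ℂ) = F s

/-- The primitive of `f` vanishing at `0`. Its iterates `volterra^[k] f` are the convolutions of `f`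
with `t ^ (k - 1) / (k - 1)!`. -/
noncomputable def volterra (f : ℝ → ℝ) (t : ℝ) : ℝ := ∫ x in (0 : ℝ)..t, f x

namespace HasLaplace

variable {c : ℝ} {f g : ℝ → ℝ} {F G : ℂ → ℂ}

theorem mono (h : HasLaplace c f F) {d : ℝ} (hcd : c ≤ d) : HasLaplace d f F :=
  fun s hs => h s (hcd.trans_lt hs)

theorem congr (h : HasLaplace c f F) (hfg : ∀ t, 0 ≤ t → f t = g t)
    (hFG : ∀ s : ℂ, c < s.re → F s = G s) : HasLaplace c g G := by
  intro s hs
  have hEq : Set.EqOn (fun t : ℝ => Complex.exp (-(s * (t : ℂ))) * (f t : ℂ))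
      (fun t : ℝ => Complex.exp (-(s * (t : ℂ))) * (g t : ℂ)) (Set.Ioi 0) := by
    intro t ht
    simp only [hfg t (le_of_lt ht)]
  obtain ⟨h1, h2⟩ := h s hs
  refine ⟨h1.congr_fun hEq measurableSet_Ioi, ?_⟩
  rw [← setIntegral_congr_fun measurableSet_Ioi hEq, h2, hFG s hs]

theorem add (hf : HasLaplace c f F) (hg : HasLaplace c g G) :
    HasLaplace c (fun t => f t + g t) (fun s => F s + G s) := by
  intro s hs
  obtain ⟨h1, h2⟩ := hf s hs
  obtain ⟨h3, h4⟩ := hg s hs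
  simp only [Complex.ofReal_add, mul_add]
  exact ⟨h1.add h3, by rw [integral_add h1 h3, h2, h4]⟩

theorem const_mul (hf : HasLaplace c f F) (a : ℝ) :
    HasLaplace c (fun t => a * f t) (fun s => a * F s) := by
  intro s hs
  obtain ⟨h1, h2⟩ := hf s hs
  simp only [Complex.ofReal_mul, mul_left_comm _ (a : ℂ)]
  exact ⟨h1.const_mul _, by rw [integral_const_mul, h2]⟩

theorem zero : HasLaplace c (fun _ => 0) (fun _ => 0) := by
  intro s _
  simp

theorem sum {ι : Type*} (S : Finset ι) {f : ι → ℝ → ℝ} {F : ι → ℂ → ℂ}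
    (h : ∀ i ∈ S, HasLaplace c (f i) (F i)) :
    HasLaplace c (fun t => ∑ i ∈ S, f i t) (fun s => ∑ i ∈ S, F i s) := by
  classical
  induction S using Finset.induction_on with
  | empty => simpa using zero
  | insert a S ha ih =>
    simp only [Finset.sum_insert ha]
    exact (h a (Finset.mem_insert_self a S)).add
      (ih fun i hi => h i (Finset.mem_insert_of_mem hi))

/-- Multiplication by an exponential shifts the transform. -/
theorem exp_mul (hf : HasLaplace c f F) (a : ℝ) :
    HasLaplace (c - a) (fun t => Real.exp (-(a * t)) * f t) (fun s => F (s + a)) := by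
  intro s hs
  have h := hf (s + a) (by simp; linarith)
  have hEq : (fun t : ℝ => Complex.exp (-(s * (t : ℂ))) * ((Real.exp (-(a * t)) * f t : ℝ) : ℂ)) =
      fun t : ℝ => Complex.exp (-((s + a) * (t : ℂ))) * (f t : ℂ) := by
    funext t
    push_cast
    rw [← mul_assoc, ← Complex.exp_add]
    congr 2
    ring
  rw [hEq]
  exact h

theorem norm_exp_mul (s : ℂ) (t x : ℝ) :
    ‖Complex.exp (-(s * (t : ℂ))) * (x : ℂ)‖ = Real.exp (-(s.re * t)) * |x| := by
  rw [norm_mul, Complex.norm_exp, Complex.norm_real, Real.norm_eq_abs]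
  simp

end HasLaplace

theorem continuous_volterra {f : ℝ → ℝ} (hf : Continuous f) : Continuous (volterra f) :=
  intervalIntegral.continuous_primitive (fun _ _ => hf.intervalIntegrable _ _) 0

theorem hasDerivAt_volterra {f : ℝ → ℝ} (hf : Continuous f) (t : ℝ) :
    HasDerivAt (volterra f) (f t) t :=
  intervalIntegral.integral_hasDerivAt_right (hf.intervalIntegrable _ _)
    hf.stronglyMeasurable.stronglyMeasurableAtFilter hf.continuousAt

theorem continuous_iterate_volterra {f : ℝ → ℝ} (hf : Continuous f) (k : ℕ) :
    Continuous (volterra^[k] f) := by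
  induction k with
  | zero => exact hf
  | succ k ih => rw [Function.iterate_succ_apply']; exact continuous_volterra ih

/-- The primitive of a function whose Laplace integral converges at `σ` grows at most like
`exp (σ * t)`. -/
theorem HasLaplace.abs_volterra_le {c : ℝ} {f : ℝ → ℝ} {F : ℂ → ℂ} (hc : 0 ≤ c)
    (hf : Continuous f) (h : HasLaplace c f F) {σ : ℝ} (hσ : c < σ) :
    ∃ M : ℝ, ∀ t : ℝ, 0 ≤ t → |volterra f t| ≤ M * Real.exp (σ * t) := by
  have hi := (h σ (by simpa using hσ)).1.norm
  simp only [HasLaplace.norm_exp_mul, Complex.ofReal_re] at hi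
  refine ⟨∫ x in Set.Ioi (0 : ℝ), Real.exp (-(σ * x)) * |f x|, fun t ht => ?_⟩
  have h1 : |volterra f t| ≤ ∫ x in (0 : ℝ)..t, |f x| :=
    intervalIntegral.abs_integral_le_integral_abs ht
  have h2 : ∫ x in (0 : ℝ)..t, |f x| ≤
      ∫ x in (0 : ℝ)..t, Real.exp (σ * t) * (Real.exp (-(σ * x)) * |f x|) := by
    refine intervalIntegral.integral_mono_on ht (hf.abs.intervalIntegrable _ _)
      (Continuous.intervalIntegrable (by fun_prop) _ _) fun x hx => ?_
    rw [← mul_assoc, ← Real.exp_add]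
    refine le_mul_of_one_le_left (abs_nonneg _) (Real.one_le_exp ?_)
    have : σ * x ≤ σ * t := mul_le_mul_of_nonneg_left hx.2 (hc.trans hσ.le)
    linarith
  have h3 : ∫ x in (0 : ℝ)..t, Real.exp (-(σ * x)) * |f x| ≤
      ∫ x in Set.Ioi (0 : ℝ), Real.exp (-(σ * x)) * |f x| := by
    rw [intervalIntegral.integral_of_le ht]
    exact setIntegral_mono_set hi (ae_of_all _ fun x => by positivity)
      (Set.Ioc_subset_Ioi_self).eventuallyLE
  rw [intervalIntegral.integral_const_mul] at h2
  calc |volterra f t| ≤ _ := h1.trans h2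
    _ ≤ _ := by rw [mul_comm]; exact mul_le_mul_of_nonneg_right h3 (Real.exp_pos _).le

/-- Integration divides the Laplace transform by `s`. -/
theorem HasLaplace.volterra {c : ℝ} {f : ℝ → ℝ} {F : ℂ → ℂ} (hc : 0 ≤ c)
    (hf : Continuous f) (h : HasLaplace c f F) :
    HasLaplace c (volterra f) (fun s => F s / s) := by
  intro s hs
  obtain ⟨σ, hσ, hσs⟩ := exists_between hs
  obtain ⟨M, hM⟩ := h.abs_volterra_le hc hf hσ
  have hs0 : s ≠ 0 := by
    rintro rfl
    simp at hs
    linarith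
  have hbound : ∀ t : ℝ, 0 ≤ t → ‖Complex.exp (-(s * (t : ℂ))) * (_root_.volterra f t : ℂ)‖ ≤
      M * Real.exp (-((s.re - σ) * t)) := by
    intro t ht
    rw [HasLaplace.norm_exp_mul]
    calc _ ≤ Real.exp (-(s.re * t)) * (M * Real.exp (σ * t)) := by
          gcongr
          exact hM t ht
      _ = _ := by
          rw [mul_left_comm, ← Real.exp_add]
          congr 2
          ring
  have hdecay : IntegrableOn (fun t : ℝ => M * Real.exp (-((s.re - σ) * t))) (Set.Ioi 0) := by
    have := (exp_neg_integrableOn_Ioi 0 (sub_pos.2 hσs)).const_mul M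
    simpa only [neg_mul, IntegrableOn] using this
  have hcv := continuous_volterra hf
  have hint : IntegrableOn
      (fun t : ℝ => Complex.exp (-(s * (t : ℂ))) * (_root_.volterra f t : ℂ)) (Set.Ioi 0) := by
    refine Integrable.mono' hdecay (Continuous.aestronglyMeasurable (by fun_prop)) ?_
    filter_upwards [ae_restrict_mem measurableSet_Ioi] with t ht using hbound t (le_of_lt ht)
  refine ⟨hint, ?_⟩
  obtain ⟨h1, h2⟩ := h s hs
  have hlim : Filter.Tendsto
      (fun t : ℝ => Complex.exp (-(s * (t : ℂ))) * (_root_.volterra f t : ℂ)) Filter.atTop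
      (nhds 0) := by
    refine squeeze_zero_norm' (a := fun t : ℝ => M * Real.exp (-((s.re - σ) * t))) ?_ ?_
    · filter_upwards [Filter.eventually_ge_atTop 0] with t ht using hbound t ht
    · have h3 : Filter.Tendsto (fun t : ℝ => Real.exp (-((s.re - σ) * t))) Filter.atTop
          (nhds 0) :=
        Real.tendsto_exp_neg_atTop_nhds_zero.comp
          (Filter.tendsto_id.const_mul_atTop (sub_pos.2 hσs))
      simpa using h3.const_mul M
  -- Integration by parts: the boundary terms of `exp (-s t) * volterra f t` vanish.
  have hderiv : ∀ t ∈ Set.Ici (0 : ℝ), HasDerivAt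
      (fun t : ℝ => Complex.exp (-(s * (t : ℂ))) * (_root_.volterra f t : ℂ))
      (-s * (Complex.exp (-(s * (t : ℂ))) * (_root_.volterra f t : ℂ)) +
        Complex.exp (-(s * (t : ℂ))) * (f t : ℂ)) t := by
    intro t _
    have ha : HasDerivAt (fun t : ℝ => Complex.exp (-(s * (t : ℂ))))
        (Complex.exp (-(s * (t : ℂ))) * (-(s * 1))) t :=
      ((((hasDerivAt_id t).ofReal_comp).const_mul s).neg).cexp
    have hb : HasDerivAt (fun t : ℝ => (_root_.volterra f t : ℂ)) (f t : ℂ) t :=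
      (hasDerivAt_volterra hf t).ofReal_comp
    exact (ha.mul hb).congr_deriv (by ring)
  have hpart := integral_Ioi_of_hasDerivAt_of_tendsto' hderiv
    ((hint.const_mul (-s)).add h1) hlim
  rw [integral_add (hint.const_mul (-s)) h1, integral_const_mul, h2] at hpart
  have h0 : _root_.volterra f 0 = 0 := by simp [_root_.volterra]
  rw [h0] at hpart
  rw [eq_div_iff hs0]
  simp only [Complex.ofReal_zero, mul_zero, sub_zero] at hpart
  linear_combination -hpart

theorem HasLaplace.iterate_volterra {c : ℝ} {f : ℝ → ℝ} {F : ℂ → ℂ} (hc : 0 ≤ c)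
    (hf : Continuous f) (h : HasLaplace c f F) (k : ℕ) :
    HasLaplace c (_root_.volterra^[k] f) (fun s => F s / s ^ k) := by
  induction k with
  | zero => simpa using h
  | succ k ih =>
    rw [Function.iterate_succ_apply']
    refine (ih.volterra hc (continuous_iterate_volterra hf k)).congr (fun _ _ => rfl) ?_
    intro s _
    rw [div_div, pow_succ]

/-- A continuous function with vanishing Laplace transform vanishes on `[0, ∞)`: on a vertical line
the transform is the difference of the characteristic functions of the finite measures whose
densities are the positive and the negative part of `exp (-σ * t) * f t`. -/
theorem HasLaplace.eq_zero {c : ℝ} {f : ℝ → ℝ} (hf : Continuous f)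
    (h : HasLaplace c f fun _ => 0) {t : ℝ} (ht : 0 ≤ t) : f t = 0 := by
  set σ : ℝ := c + 1 with hσ
  set μ : Measure ℝ := volume.restrict (Set.Ioi 0) with hμ
  set u : ℝ → ℝ := fun t => Real.exp (-(σ * t)) * f t with hu
  have hcu : Continuous u := by fun_prop
  have hui : Integrable u μ := by
    have hi := (h σ (by simp [hσ])).1
    refine (integrable_norm_iff hcu.aestronglyMeasurable).1 ?_
    have hn := hi.norm
    simp only [HasLaplace.norm_exp_mul, Complex.ofReal_re] at hn
    refine hn.congr (ae_of_all _ fun t => ?_)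
    simp [hu]
  have hcu' : Continuous fun t => -u t := hcu.neg
  have hui' : Integrable (fun t => -u t) μ := hui.neg
  have hfin : ∀ v : ℝ → ℝ, Integrable v μ →
      IsFiniteMeasure (μ.withDensity fun t => ENNReal.ofReal (v t)) := fun v hv =>
    isFiniteMeasure_withDensity_ofReal hv.2
  have hchar : ∀ v : ℝ → ℝ, Measurable v → ∀ ω : ℝ,
      charFun (μ.withDensity fun t => ENNReal.ofReal (v t)) ω =
        ∫ t, Complex.exp (ω * t * Complex.I) * ((max (v t) 0 : ℝ) : ℂ) ∂μ := by
    intro v hv ω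
    rw [charFun_apply_real, integral_withDensity_eq_integral_toReal_smul hv.ennreal_ofReal
      (ae_of_all _ fun _ => ENNReal.ofReal_lt_top)]
    refine integral_congr_ae (ae_of_all _ fun t => ?_)
    simp only [ENNReal.toReal_ofReal', Complex.real_smul, mul_comm]
  have := hfin u hui
  have := hfin _ hui'
  have hInt : ∀ v : ℝ → ℝ, Integrable v μ → ∀ ω : ℝ,
      Integrable (fun t : ℝ => Complex.exp (ω * t * Complex.I) * ((max (v t) 0 : ℝ) : ℂ)) μ := by
    intro v hv ω
    refine Integrable.bdd_mul (c := 1) hv.pos_part.ofReal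
      (Continuous.aestronglyMeasurable (by fun_prop)) (ae_of_all _ fun t => ?_)
    rw [← Complex.ofReal_mul, Complex.norm_exp_ofReal_mul_I]
  have hmeas : (μ.withDensity fun t => ENNReal.ofReal (u t)) =
      μ.withDensity fun t => ENNReal.ofReal (-u t) := by
    refine Measure.ext_of_charFun (funext fun ω => ?_)
    rw [hchar u hcu.measurable, hchar _ hcu'.measurable, ← sub_eq_zero,
      ← integral_sub (hInt u hui ω) (hInt _ hui' ω)]
    refine Eq.trans (integral_congr_ae (ae_of_all _ fun t => ?_))
      (h ((σ : ℂ) - ω * Complex.I) (by simp [hσ])).2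
    have hpm : max (u t) 0 - max (-u t) 0 = u t := max_zero_sub_max_neg_zero_eq_self (u t)
    have hsplit : Complex.exp (-((σ - ω * Complex.I) * t)) =
        Complex.exp (ω * t * Complex.I) * Complex.exp (-(σ * t)) := by
      rw [← Complex.exp_add]
      congr 1
      ring
    simp only
    rw [← mul_sub, ← Complex.ofReal_sub, hpm, hsplit, hu]
    push_cast
    ring
  have hae := (withDensity_eq_iff_of_sigmaFinite hcu.measurable.ennreal_ofReal.aemeasurable
    hcu'.measurable.ennreal_ofReal.aemeasurable).1 hmeas
  have hae0 : u =ᵐ[volume.restrict (Set.Ici 0)] fun _ => (0 : ℝ) := by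
    rw [restrict_Ioi_eq_restrict_Ici.symm]
    filter_upwards [hae] with t ht
    rcases le_total 0 (u t) with h0 | h0
    · rw [ENNReal.ofReal_of_nonpos (neg_nonpos.2 h0), ENNReal.ofReal_eq_zero] at ht
      exact le_antisymm ht h0
    · rw [ENNReal.ofReal_of_nonpos h0, eq_comm, ENNReal.ofReal_eq_zero] at ht
      linarith
  have h0 := Measure.eqOn_of_ae_eq hae0 hcu.continuousOn continuousOn_const
    (by rw [interior_Ici, closure_Ioi]) ht
  exact (mul_eq_zero.1 h0).resolve_left (Real.exp_pos _).ne'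

/-- A continuous function is determined on `[0, ∞)` by its Laplace transform. -/
theorem HasLaplace.unique {c : ℝ} {f g : ℝ → ℝ} {F : ℂ → ℂ} (hf : Continuous f)
    (hg : Continuous g) (h : HasLaplace c f F) (h' : HasLaplace c g F) {t : ℝ} (ht : 0 ≤ t) :
    f t = g t := by
  have hsub : HasLaplace c (fun t => f t + -1 * g t) fun _ => 0 :=
    (h.add (h'.const_mul (-1))).congr (fun _ _ => rfl) (by intro s _; push_cast; ring)
  have := hsub.eq_zero (by fun_prop) ht
  linarith

/-! ### Impulse responses with all poles at the origin -/

theorem volterra_pow_div_factorial (k : ℕ) :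
    volterra (fun t => t ^ k / (k.factorial : ℝ)) =
      fun t => t ^ (k + 1) / ((k + 1).factorial : ℝ) := by
  funext t
  simp only [volterra, intervalIntegral.integral_div, integral_pow, Nat.factorial_succ]
  push_cast
  field_simp
  simp

theorem hasLaplace_pow_div_factorial (k : ℕ) :
    HasLaplace 0 (fun t => t ^ k / (k.factorial : ℝ)) (fun s => 1 / s ^ (k + 1)) := by
  induction k with
  | zero =>
    intro s hs
    have hs' : (-s).re < 0 := by simpa using hs
    simp only [pow_zero, Nat.factorial_zero, Nat.cast_one, div_one, Complex.ofReal_one, mul_one,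
      zero_add, pow_one, ← neg_mul]
    refine ⟨integrableOn_exp_mul_complex_Ioi hs' 0, ?_⟩
    rw [integral_exp_mul_complex_Ioi hs' 0]
    simp [neg_div_neg_eq]
  | succ k ih =>
    have h := ih.volterra le_rfl (by fun_prop)
    rw [volterra_pow_div_factorial] at h
    refine h.congr (fun _ _ => rfl) fun s _ => ?_
    rw [div_div, ← pow_succ]

/-- The impulse response of `A(s) / s ^ n`, for `A` of degree less than `n`. It is a polynomial in
time. -/
noncomputable def impulsePoly (n : ℕ) (A : ℝ[X]) : ℝ[X] :=
  ∑ j ∈ Finset.range n, monomial (n - 1 - j) (A.coeff j / ((n - 1 - j).factorial : ℝ))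

theorem eval_impulsePoly (n : ℕ) (A : ℝ[X]) (t : ℝ) :
    (impulsePoly n A).eval t =
      ∑ j ∈ Finset.range n, A.coeff j * (t ^ (n - 1 - j) / ((n - 1 - j).factorial : ℝ)) := by
  simp only [impulsePoly, eval_finsetSum, eval_monomial]
  exact Finset.sum_congr rfl fun j _ => by ring

theorem hasLaplace_impulsePoly {n : ℕ} {A : ℝ[X]} (hA : A.natDegree < n) :
    HasLaplace 0 (fun t => (impulsePoly n A).eval t) (fun s => aeval s A / s ^ n) := by
  have h := HasLaplace.sum (Finset.range n) fun j _ =>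
    (hasLaplace_pow_div_factorial (n - 1 - j)).const_mul (A.coeff j)
  refine h.congr (fun t _ => (eval_impulsePoly n A t).symm) fun s hs => ?_
  have hs0 : s ≠ 0 := by
    rintro rfl
    simp at hs
  rw [aeval_eq_sum_range' hA, Finset.sum_div]
  refine Finset.sum_congr rfl fun j hj => ?_
  rw [Finset.mem_range] at hj
  obtain ⟨k, rfl⟩ := Nat.exists_eq_add_of_lt hj
  have hk : j + k + 1 - 1 - j + 1 = k + 1 := by omega
  rw [hk, Algebra.smul_def, Complex.coe_algebraMap, add_assoc, pow_add]
  field_simp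
  ring

theorem coeff_impulsePoly (n : ℕ) (A : ℝ[X]) {j : ℕ} (hj : j < n) :
    (impulsePoly n A).coeff (n - 1 - j) = A.coeff j / ((n - 1 - j).factorial : ℝ) := by
  simp only [impulsePoly, finsetSum_coeff, coeff_monomial]
  rw [Finset.sum_eq_single j]
  · simp
  · intro i hi hij
    rw [Finset.mem_range] at hi
    rw [if_neg (by omega)]
  · simp [hj]

theorem natDegree_impulsePoly_le (n : ℕ) (A : ℝ[X]) : (impulsePoly n A).natDegree ≤ n - 1 :=
  natDegree_sum_le_of_forall_le _ _ fun _ _ =>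
    (natDegree_monomial_le _).trans (Nat.sub_le _ _)

theorem impulsePoly_ne_zero {n : ℕ} {A : ℝ[X]} (hA : A.natDegree < n) (hA0 : A ≠ 0) :
    impulsePoly n A ≠ 0 := by
  intro h
  have := coeff_impulsePoly n A hA
  rw [h, coeff_zero, eq_comm, div_eq_zero_iff] at this
  rcases this with h0 | h0
  · exact hA0 (leadingCoeff_eq_zero.1 h0)
  · exact Nat.factorial_ne_zero _ (by exact_mod_cast h0)

theorem transformedNumerator_eq_sum (n : ℕ) (A : ℝ[X]) :
    transformedNumerator n A =
      ∑ j ∈ Finset.range n, C (A.coeff j / ((n - 1 - j).factorial : ℝ)) * X ^ j := by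
  refine Finset.sum_nbij' (fun i => n - i) (fun j => n - j) ?_ ?_ ?_ ?_ ?_ <;> intro i hi <;>
    simp only [Finset.mem_Icc, Finset.mem_range, numCoeff] at *
  · omega
  · omega
  · omega
  · omega
  · rw [show n - 1 - (n - i) = i - 1 by omega]

theorem eval_transformedNumerator (n : ℕ) (A : ℝ[X]) (x : ℝ) :
    (transformedNumerator n A).eval x =
      ∑ j ∈ Finset.range n, A.coeff j / ((n - 1 - j).factorial : ℝ) * x ^ j := by
  simp only [transformedNumerator_eq_sum, eval_finsetSum, eval_mul, eval_C, eval_pow, eval_X]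

theorem coeff_transformedNumerator {n : ℕ} {A : ℝ[X]} (hA : A.natDegree < n) (k : ℕ) :
    (transformedNumerator n A).coeff k = A.coeff k / ((n - 1 - k).factorial : ℝ) := by
  simp only [transformedNumerator_eq_sum, finsetSum_coeff, coeff_C_mul, coeff_X_pow, mul_ite,
    mul_one, mul_zero, Finset.sum_ite_eq, Finset.mem_range]
  split_ifs with hk
  · rfl
  · rw [coeff_eq_zero_of_natDegree_lt (by omega), zero_div]

/-- The transformed numerator is the reversal of the impulse response of `A(s) / s ^ n`. -/
theorem eval_impulsePoly_eq_pow_mul {n : ℕ} (A : ℝ[X]) {t : ℝ} (ht : t ≠ 0) :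
    (impulsePoly n A).eval t = t ^ (n - 1) * (transformedNumerator n A).eval t⁻¹ := by
  rw [eval_impulsePoly, eval_transformedNumerator, Finset.mul_sum]
  refine Finset.sum_congr rfl fun j hj => ?_
  rw [Finset.mem_range] at hj
  have : t ^ (n - 1) = t ^ (n - 1 - j) * t ^ j := by
    rw [← pow_add]
    congr 1
    omega
  rw [this, inv_pow]
  field_simp

/-! ### Real polynomials with stable roots -/

/-- A complex polynomial taking real values at infinitely many real points has real
coefficients. -/
theorem exists_map_eq_of_infinite_im_eq_zero (P : ℂ[X])
    (h : Set.Infinite {x : ℝ | (P.eval (x : ℂ)).im = 0}) :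
    ∃ R : ℝ[X], R.map (algebraMap ℝ ℂ) = P := by
  have hconj : P.map (starRingEnd ℂ) = P := by
    refine eq_of_infinite_eval_eq _ _ ((h.image Complex.ofReal_injective.injOn).mono ?_)
    rintro _ ⟨x, hx, rfl⟩
    have : (P.map (starRingEnd ℂ)).eval (x : ℂ) = starRingEnd ℂ (P.eval (x : ℂ)) := by
      conv_lhs => rw [← Complex.conj_ofReal x]
      rw [eval_map, eval₂_hom]
    exact this.trans (Complex.conj_eq_iff_im.2 hx)
  rw [← mem_lifts, lifts_iff_coeff_lifts]
  intro k
  have hk : starRingEnd ℂ (P.coeff k) = P.coeff k := by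
    conv_rhs => rw [← hconj, coeff_map]
  obtain ⟨r, hr⟩ := Complex.conj_eq_iff_real.1 hk
  exact ⟨r, hr.symm⟩

theorem Polynomial.coeff_mul_nonneg {P Q : ℝ[X]} (hP : ∀ k, 0 ≤ P.coeff k)
    (hQ : ∀ k, 0 ≤ Q.coeff k) (k : ℕ) : 0 ≤ (P * Q).coeff k := by
  rw [coeff_mul]
  exact Finset.sum_nonneg fun i _ => mul_nonneg (hP _) (hQ _)

/-- A monic real polynomial all of whose roots have non-positive real part is a product of factors
`X + a` and `X ^ 2 + a X + b` with `a, b ≥ 0`, hence has non-negative coefficients. -/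
theorem Polynomial.Monic.coeff_nonneg_of_re_root_nonpos {P : ℝ[X]} (hP : P.Monic)
    (h : ∀ w : ℂ, aeval w P = 0 → w.re ≤ 0) (k : ℕ) : 0 ≤ P.coeff k := by
  induction hn : P.natDegree using Nat.strong_induction_on generalizing P k with
  | _ N ih =>
  have step : ∀ D Q : ℝ[X], P = D * Q → D.Monic → 0 < D.natDegree → (∀ k, 0 ≤ D.coeff k) →
      0 ≤ P.coeff k := by
    intro D Q hDQ hD hdeg hDk
    have hQ : Q.Monic := hD.of_mul_monic_left (hDQ ▸ hP)
    have hlt : Q.natDegree < N := by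
      rw [← hn, hDQ, hD.natDegree_mul hQ]
      omega
    have hQk := fun k => ih _ hlt hQ (fun w hw => h w (by rw [hDQ, map_mul, hw, mul_zero])) k rfl
    rw [hDQ]
    exact coeff_mul_nonneg hDk hQk k
  rcases Nat.eq_zero_or_pos P.natDegree with h0 | hpos
  · rw [hP.natDegree_eq_zero.1 h0, coeff_one]
    split_ifs <;> norm_num
  obtain ⟨w, hw⟩ := IsAlgClosed.exists_aeval_eq_zero ℂ P
    (natDegree_pos_iff_degree_pos.1 hpos).ne'
  have hre := h w hw
  by_cases him : w.im = 0
  · have hwr : w = (w.re : ℂ) := Complex.ext rfl (by simp [him])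
    have hroot : P.IsRoot w.re := by
      rw [hwr, ← Complex.coe_algebraMap, aeval_algebraMap_apply] at hw
      simpa using hw
    obtain ⟨Q, hQ⟩ := dvd_iff_isRoot.2 hroot
    refine step _ Q hQ (monic_X_sub_C _) (by simp) fun k => ?_
    rw [coeff_sub, coeff_X, coeff_C]
    split_ifs <;> linarith
  · obtain ⟨Q, hQ⟩ := P.quadratic_dvd_of_aeval_eq_zero_im_ne_zero hw him
    have hd : (X ^ 2 - C (2 * w.re) * X + C (‖w‖ ^ 2) : ℝ[X]).natDegree = 2 := by
      compute_degree!
    refine step _ Q hQ ?_ (by omega) fun k => ?_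
    · monicity!
    · simp only [coeff_add, coeff_sub, coeff_X_pow, coeff_C_mul, coeff_X, coeff_C]
      have := sq_nonneg ‖w‖
      split_ifs <;> first | omega | nlinarith

/-! ### Iterated primitives of non-negative functions -/

section IteratedPrimitives

variable {f : ℝ → ℝ}

theorem iterate_volterra_nonneg (hf : ∀ t, 0 ≤ t → 0 ≤ f t) (k : ℕ) {t : ℝ} (ht : 0 ≤ t) :
    0 ≤ volterra^[k] f t := by
  induction k generalizing t with
  | zero => exact hf t ht
  | succ k ih =>
    rw [Function.iterate_succ_apply']
    exact intervalIntegral.integral_nonneg ht fun x hx => ih hx.1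

theorem iterate_volterra_eq_zero {T : ℝ} (hf : ∀ t, 0 ≤ t → t ≤ T → f t = 0) (k : ℕ)
    {t : ℝ} (ht : 0 ≤ t) (htT : t ≤ T) : volterra^[k] f t = 0 := by
  induction k generalizing t with
  | zero => exact hf t ht htT
  | succ k ih =>
    rw [Function.iterate_succ_apply', volterra]
    refine intervalIntegral.integral_zero_ae (ae_of_all _ fun x hx => ?_)
    rw [Set.uIoc_of_le ht] at hx
    exact ih hx.1.le (hx.2.trans htT)

/-- The primitive of a non-negative function vanishes at `T` only if the function vanishes on
`[0, T]`. -/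
theorem eq_zero_of_volterra_eq_zero (hc : Continuous f) (hf : ∀ t, 0 ≤ t → 0 ≤ f t) {T : ℝ}
    (h : volterra f T = 0) {t : ℝ} (ht : 0 ≤ t) (htT : t ≤ T) (hT : 0 < T) : f t = 0 := by
  by_contra hne
  have hpos : 0 < ∫ x in (0 : ℝ)..T, f x :=
    intervalIntegral.integral_pos hT hc.continuousOn (fun x hx => hf x hx.1.le)
      ⟨t, ⟨ht, htT⟩, lt_of_le_of_ne (hf t ht) (Ne.symm hne)⟩
  exact hpos.ne' h

theorem iterate_volterra_pos (hc : Continuous f) (hf : ∀ t, 0 < t → 0 < volterra f t) (k : ℕ)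
    {t : ℝ} (ht : 0 < t) : 0 < volterra^[k + 1] f t := by
  induction k generalizing t with
  | zero => exact hf t ht
  | succ k ih =>
    rw [Function.iterate_succ_apply']
    exact intervalIntegral.intervalIntegral_pos_of_pos_on
      ((continuous_iterate_volterra hc _).intervalIntegrable _ _) (fun x hx => ih hx.1) ht

/-- The `(k + 1)`-st iterated primitive of a non-negative function grows at least like `t ^ k`,
unless the function vanishes on `[0, 1]`. -/
theorem le_iterate_volterra (hc : Continuous f) (hf : ∀ t, 0 ≤ t → 0 ≤ f t) (k : ℕ)
    {t : ℝ} (ht : 1 ≤ t) :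
    volterra f 1 * ((t - 1) ^ k / (k.factorial : ℝ)) ≤ volterra^[k + 1] f t := by
  have hsplit : ∀ (k : ℕ) (t : ℝ), 1 ≤ t → ∫ x in (1 : ℝ)..t, volterra^[k] f x ≤
      volterra^[k + 1] f t := by
    intro k t ht
    have hi := fun a b : ℝ => (continuous_iterate_volterra hc k).intervalIntegrable
      (μ := volume) a b
    rw [Function.iterate_succ_apply', volterra,
      ← intervalIntegral.integral_add_adjacent_intervals (hi 0 1) (hi 1 t)]
    have := intervalIntegral.integral_nonneg (μ := volume) zero_le_one
      fun x (hx : x ∈ Set.Icc (0 : ℝ) 1) => iterate_volterra_nonneg hf k hx.1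
    linarith
  induction k generalizing t with
  | zero =>
    have hi := fun a b : ℝ => hc.intervalIntegrable (μ := volume) a b
    have h1 : volterra f 1 + ∫ x in (1 : ℝ)..t, f x = volterra f t :=
      intervalIntegral.integral_add_adjacent_intervals (hi 0 1) (hi 1 t)
    have h2 : 0 ≤ ∫ x in (1 : ℝ)..t, f x :=
      intervalIntegral.integral_nonneg ht fun x hx => hf x (zero_le_one.trans hx.1)
    simp
    linarith
  | succ k ih =>
    refine le_trans (le_of_eq ?_) ((intervalIntegral.integral_mono_on ht
      (Continuous.intervalIntegrable (by fun_prop) _ _)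
      ((continuous_iterate_volterra hc _).intervalIntegrable _ _)
      fun x hx => ih hx.1).trans (hsplit (k + 1) t ht))
    rw [intervalIntegral.integral_const_mul,
      intervalIntegral.integral_comp_sub_right (fun x => x ^ k / (k.factorial : ℝ)), sub_self]
    congr 1
    exact (congrFun (volterra_pow_div_factorial k) (t - 1)).symm

end IteratedPrimitives

/-! ### Necessity -/

/-- Comparison of a polynomial with a power from below forces the degree up. -/
theorem Polynomial.le_natDegree_of_forall_pow_le_eval {Q : ℝ[X]} {a : ℝ} (ha : 0 < a) {k : ℕ}
    (h : ∀ t : ℝ, 1 ≤ t → a * (t - 1) ^ k ≤ Q.eval t) : k ≤ Q.natDegree := by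
  by_contra! hlt
  set D : ℝ[X] := C a * (X - C 1) ^ k with hD
  have hDdeg : D.natDegree = k := by
    rw [hD, natDegree_C_mul ha.ne', natDegree_pow, natDegree_X_sub_C, mul_one]
  have hDlead : D.leadingCoeff = a := by
    rw [hD, leadingCoeff_mul, leadingCoeff_C, ((monic_X_sub_C (1 : ℝ)).pow k).leadingCoeff, mul_one]
  have hlead : (Q - D).leadingCoeff = -a := by
    rw [leadingCoeff_sub_of_degree_lt' (degree_lt_degree (hlt.trans_eq hDdeg.symm)), hDlead]
  have hne : Q - D ≠ 0 := by
    rw [← leadingCoeff_ne_zero, hlead]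
    exact neg_ne_zero.2 ha.ne'
  obtain ⟨x, hx⟩ := exists_max_root _ hne
  have hneg := eval_lt_zero_of_roots_lt_of_leadingCoeff_nonpos (P := Q - D) (x := max x 1 + 1)
    (fun y hy => by linarith [hx y hy, le_max_left x 1]) (by rw [hlead]; linarith)
  have := h (max x 1 + 1) (by linarith [le_max_right x 1])
  simp only [hD, eval_sub, eval_mul, eval_C, eval_pow, eval_X] at hneg
  linarith

/-- Multiplying a non-negative impulse response `h` of `B / P` by `P(s) / s ^ n = ∑ P_j / s ^ (n-j)`
amounts to adding non-negative multiples of iterated primitives of `h`, and yields the impulse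
response of `B(s) / s ^ n`. -/
theorem sum_coeff_mul_iterate_volterra_eq {n : ℕ} {B P : ℝ[X]} {c : ℝ} {h : ℝ → ℝ}
    (hBn : B.natDegree < n) (hPn : P.natDegree = n) (hc : 0 ≤ c)
    (hP : ∀ s : ℂ, c < s.re → aeval s P ≠ 0) (hh : Continuous h)
    (hL : HasLaplace c h fun s => aeval s B / aeval s P) {t : ℝ} (ht : 0 ≤ t) :
    ∑ j ∈ Finset.range (n + 1), P.coeff j * volterra^[n - j] h t =
      (impulsePoly n B).eval t := by
  have hsum := HasLaplace.sum (Finset.range (n + 1)) fun j _ =>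
    (hL.iterate_volterra hc hh (n - j)).const_mul (P.coeff j)
  have hB := (hasLaplace_impulsePoly hBn).mono hc
  refine HasLaplace.unique (continuous_finsetSum _ fun j _ =>
    (continuous_iterate_volterra hh _).const_mul _) (impulsePoly n B).continuous
    (hsum.congr (fun _ _ => rfl) fun s hs => ?_) hB ht
  have hs0 : s ≠ 0 := by
    rintro rfl
    simp at hs
    linarith
  have hkey : ∀ j ∈ Finset.range (n + 1), (P.coeff j : ℂ) *
      (aeval s B / aeval s P / s ^ (n - j)) =
        P.coeff j • s ^ j * (aeval s B / aeval s P / s ^ n) := by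
    intro j hj
    have hpow : s ^ n = s ^ (n - j) * s ^ j := by
      rw [← pow_add, Nat.sub_add_cancel (Nat.lt_succ_iff.1 (Finset.mem_range.1 hj))]
    rw [hpow, Algebra.smul_def, Complex.coe_algebraMap]
    field_simp
  rw [Finset.sum_congr rfl hkey, ← Finset.sum_mul, ← aeval_eq_sum_range' (by omega)]
  have := hP s hs
  field_simp

theorem not_isRoot_transformedNumerator {n : ℕ} {B P : ℝ[X]} {c : ℝ} {h : ℝ → ℝ}
    (hB0 : B ≠ 0) (hBn : B.natDegree < n) (hPn : P.natDegree = n) (hc : 0 ≤ c)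
    (hP : ∀ s : ℂ, c < s.re → aeval s P ≠ 0) (hcoeff : ∀ k, 0 ≤ P.coeff k)
    (hcoeff0 : P.coeff 0 ≠ 0) (hh : Continuous h) (hnn : ∀ t, 0 ≤ t → 0 ≤ h t)
    (hL : HasLaplace c h fun s => aeval s B / aeval s P) (x : ℝ) (hx : 0 ≤ x) :
    ¬ (transformedNumerator n B).IsRoot x := by
  have hQ := fun t (ht : 0 ≤ t) =>
    sum_coeff_mul_iterate_volterra_eq hBn hPn hc hP hh hL ht
  have hP0 : 0 < P.coeff 0 := lt_of_le_of_ne (hcoeff 0) hcoeff0.symm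
  -- Otherwise the impulse response of `B / s ^ n`, a non-zero polynomial, vanishes near `0`.
  have hV : ∀ t, 0 < t → 0 < volterra h t := by
    intro T hT
    refine lt_of_le_of_ne (iterate_volterra_nonneg hnn 1 hT.le) fun h0 => ?_
    refine impulsePoly_ne_zero hBn hB0 (eq_zero_of_infinite_isRoot _
      ((Set.Icc_infinite hT).mono fun t ht => ?_))
    refine (hQ t ht.1).symm.trans (Finset.sum_eq_zero fun j _ => ?_)
    rw [iterate_volterra_eq_zero (fun t h1 h2 => eq_zero_of_volterra_eq_zero hh hnn h0.symm h1 h2 hT)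
      _ ht.1 ht.2, mul_zero]
  have hlow : ∀ t, 0 ≤ t → P.coeff 0 * volterra^[n] h t ≤ (impulsePoly n B).eval t := by
    intro t ht
    rw [← hQ t ht]
    exact Finset.single_le_sum (f := fun j => P.coeff j * volterra^[n - j] h t)
      (fun j _ => mul_nonneg (hcoeff j) (iterate_volterra_nonneg hnn _ ht))
      (Finset.mem_range.2 n.succ_pos)
  obtain ⟨k, rfl⟩ : ∃ k, n = k + 1 := ⟨n - 1, by omega⟩
  intro hroot
  rcases hx.eq_or_lt with rfl | hx
  · -- At `x = 0` the impulse response of `B / s ^ n` would have degree less than `n - 1`.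
    have hcoeffB : (impulsePoly (k + 1) B).coeff k = 0 := by
      have h1 := coeff_impulsePoly (k + 1) B k.succ_pos
      have h2 : (transformedNumerator (k + 1) B).eval 0 = 0 := hroot
      rw [eval_transformedNumerator, Finset.sum_eq_single 0
        (fun j _ hj => by rw [zero_pow hj, mul_zero]) (by simp), pow_zero, mul_one] at h2
      exact h1.trans h2
    have hle : k ≤ (impulsePoly (k + 1) B).natDegree := by
      refine le_natDegree_of_forall_pow_le_eval
        (a := P.coeff 0 * (volterra h 1 / (k.factorial : ℝ))) ?_ fun t ht => ?_
      · have := hV 1 one_pos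
        positivity
      · refine le_trans (le_of_eq ?_) ((mul_le_mul_of_nonneg_left
          (le_iterate_volterra hh hnn k ht) hP0.le).trans (hlow t (zero_le_one.trans ht)))
        ring
    have hdeg : (impulsePoly (k + 1) B).natDegree = k :=
      le_antisymm (natDegree_impulsePoly_le _ _) hle
    refine impulsePoly_ne_zero hBn hB0 (leadingCoeff_eq_zero.1 ?_)
    rw [leadingCoeff, hdeg, hcoeffB]
  · have hpos := (mul_pos hP0 (iterate_volterra_pos hh hV k (inv_pos.2 hx))).trans_le
      (hlow _ (inv_pos.2 hx).le)
    rw [eval_impulsePoly_eq_pow_mul B (inv_ne_zero hx.ne'), inv_inv, hroot.eq_zero, mul_zero] at hpos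
    exact hpos.false

/-! ### Sufficiency -/

theorem eval_impulsePoly_eq_pow_mul_sum {n m : ℕ} {A : ℝ[X]} (hA : A.natDegree ≤ m) (hmn : m < n)
    (t : ℝ) : (impulsePoly n A).eval t = t ^ (n - 1 - m) *
      ∑ j ∈ Finset.range (m + 1), A.coeff j * (t ^ (m - j) / ((n - 1 - j).factorial : ℝ)) := by
  rw [eval_impulsePoly, Finset.mul_sum]
  symm
  refine (Finset.sum_congr rfl fun j hj => ?_).trans (Finset.sum_subset
    (Finset.range_subset_range.2 hmn) fun j _ hj => ?_)
  · rw [Finset.mem_range] at hj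
    have : t ^ (n - 1 - j) = t ^ (n - 1 - m) * t ^ (m - j) := by
      rw [← pow_add]
      congr 1
      omega
    rw [this]
    ring
  · rw [Finset.mem_range, not_lt] at hj
    rw [coeff_eq_zero_of_natDegree_lt (by omega), zero_mul]

theorem continuous_coeff_taylor (B : ℝ[X]) (j : ℕ) :
    Continuous fun ε : ℝ => (taylor (-ε) B).coeff j := by
  simp only [taylor_coeff]
  exact (hasseDeriv j B).continuous.comp continuous_neg

/-- Positivity on the compact interval `[0, 1]` is stable under perturbation of a parameter. -/
theorem eventually_forall_mem_Icc_pos {G : ℝ × ℝ → ℝ} (hG : Continuous G)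
    (h : ∀ x ∈ Set.Icc (0 : ℝ) 1, 0 < G (0, x)) :
    ∀ᶠ ε in nhds (0 : ℝ), ∀ x ∈ Set.Icc (0 : ℝ) 1, 0 < G (ε, x) :=
  isCompact_Icc.eventually_forall_of_forall_eventually (P := fun ε x => 0 < G (ε, x))
    fun x hx => (hG.tendsto (0, x)).eventually (lt_mem_nhds (h x hx))

/-- The impulse response of `B(s - ε) / s ^ n` stays non-negative for small `ε`. Times `t ∈ [0, 1]`
are controlled by the impulse response divided by its exact power of `t`, and times `t ≥ 1` by the
transformed numerator at `t⁻¹ ∈ [0, 1]`. -/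
theorem exists_pos_impulsePoly_taylor_nonneg {n : ℕ} {B : ℝ[X]} (hBn : B.natDegree < n)
    (hlead : 0 < B.leadingCoeff) (hpos : ∀ x, 0 ≤ x → 0 < (transformedNumerator n B).eval x) :
    ∃ ε > 0, ∀ t, 0 ≤ t → 0 ≤ (impulsePoly n (taylor (-ε) B)).eval t := by
  set m := B.natDegree with hm
  set G₁ : ℝ × ℝ → ℝ := fun z => ∑ j ∈ Finset.range n,
    (taylor (-z.1) B).coeff j / ((n - 1 - j).factorial : ℝ) * z.2 ^ j with hG₁
  set G₂ : ℝ × ℝ → ℝ := fun z => ∑ j ∈ Finset.range (m + 1),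
    (taylor (-z.1) B).coeff j * (z.2 ^ (m - j) / ((n - 1 - j).factorial : ℝ)) with hG₂
  have hc₁ : Continuous G₁ := continuous_finsetSum _ fun j _ =>
    (((continuous_coeff_taylor B j).comp continuous_fst).div_const _).mul (continuous_snd.pow j)
  have hc₂ : Continuous G₂ := continuous_finsetSum _ fun j _ =>
    ((continuous_coeff_taylor B j).comp continuous_fst).mul ((continuous_snd.pow _).div_const _)
  have e₁ : ∀ ε x, (transformedNumerator n (taylor (-ε) B)).eval x = G₁ (ε, x) := fun ε x =>
    eval_transformedNumerator n _ x
  have e₂ : ∀ ε t, (impulsePoly n (taylor (-ε) B)).eval t = t ^ (n - 1 - m) * G₂ (ε, t) :=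
    fun ε t => eval_impulsePoly_eq_pow_mul_sum (natDegree_taylor B _).le hBn t
  have ev₁ := eventually_forall_mem_Icc_pos hc₁ fun x hx => by
    rw [← e₁, neg_zero, taylor_zero]
    exact hpos x hx.1
  have ev₂ := eventually_forall_mem_Icc_pos hc₂ fun t ht => by
    rcases ht.1.eq_or_lt with rfl | ht0
    · simp only [hG₂, neg_zero, taylor_zero]
      rw [Finset.sum_eq_single m]
      · rw [Nat.sub_self, pow_zero]
        exact mul_pos hlead (by positivity)
      · intro j hj hjm
        rw [Finset.mem_range] at hj
        rw [zero_pow (by omega), zero_div, mul_zero]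
      · simp
    · have h1 := e₂ 0 t
      rw [neg_zero, taylor_zero, eval_impulsePoly_eq_pow_mul B ht0.ne'] at h1
      have h2 := mul_pos (pow_pos ht0 (n - 1)) (hpos _ (inv_pos.2 ht0).le)
      rw [h1] at h2
      exact pos_of_mul_pos_right h2 (pow_pos ht0 _).le
  obtain ⟨ε, ⟨h₁, h₂⟩, hε⟩ := (((ev₁.and ev₂).filter_mono nhdsWithin_le_nhds).and
    (self_mem_nhdsWithin (s := Set.Ioi (0 : ℝ)))).exists
  refine ⟨ε, hε, fun t ht => ?_⟩
  rcases le_total t 1 with h1 | h1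
  · rw [e₂]
    exact mul_nonneg (pow_nonneg ht _) (h₂ t ⟨ht, h1⟩).le
  · rw [eval_impulsePoly_eq_pow_mul _ (by positivity), e₁]
    exact mul_nonneg (pow_nonneg ht _)
      (h₁ _ ⟨inv_nonneg.2 ht, inv_le_one_of_one_le₀ h1⟩).le

theorem transformedNumerator_eval_pos {n : ℕ} {B : ℝ[X]} (hBn : B.natDegree < n)
    (hlead : 0 < B.leadingCoeff)
    (h : ∀ x : ℝ, 0 ≤ x → ¬ (transformedNumerator n B).IsRoot x) {x : ℝ} (hx : 0 ≤ x) :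
    0 < (transformedNumerator n B).eval x := by
  refine zero_lt_eval_of_roots_lt_of_leadingCoeff_nonneg (fun y hy => ?_) ?_
  · by_contra! hxy
    exact h y (hx.trans hxy) hy
  · have hne : (transformedNumerator n B).coeff B.natDegree ≠ 0 := by
      rw [coeff_transformedNumerator hBn]
      exact div_ne_zero hlead.ne' (by positivity)
    have hdeg : (transformedNumerator n B).natDegree = B.natDegree := by
      refine natDegree_eq_of_le_of_coeff_ne_zero (natDegree_le_iff_coeff_eq_zero.2 fun k hk => ?_) hne
      rw [coeff_transformedNumerator hBn, coeff_eq_zero_of_natDegree_lt hk, zero_div]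
    rw [leadingCoeff, hdeg, coeff_transformedNumerator hBn]
    exact div_nonneg hlead.le (by positivity)

/-! ### The closed loop -/

theorem closedLoopTransfer_eq_div {m n : ℕ} {K : ℝ} {z : Fin m → ℂ} {B : ℝ[X]}
    (hB : B.map (algebraMap ℝ ℂ) = C (K : ℂ) * ∏ i, (X - C (z i))) (p : Fin n → ℂ) (s : ℂ) :
    closedLoopTransfer K z p s = aeval s B / (∏ i, (X - C (p i))).eval s := by
  rw [aeval_def, ← eval_map, hB]
  simp [closedLoopTransfer, eval_prod]

/-- The denominator of a non-zero real-valued transfer function with real numerator is real. -/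
theorem exists_real_denominator {B : ℝ[X]} (hB0 : B ≠ 0) {D : ℂ[X]} {c : ℝ} {h : ℝ → ℝ}
    (hL : HasLaplace c h fun s => aeval s B / D.eval s) :
    ∃ P : ℝ[X], P.map (algebraMap ℝ ℂ) = D := by
  refine exists_map_eq_of_infinite_im_eq_zero D
    (((Set.Ioi_infinite c).sdiff (finite_setOfPred_isRoot hB0)).mono ?_)
  rintro x ⟨hx, hxB⟩
  have hint := (hL x (by simpa using hx)).2
  have hreal : ∫ t in Set.Ioi (0 : ℝ), Complex.exp (-((x : ℂ) * (t : ℂ))) * (h t : ℂ) =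
      ((∫ t in Set.Ioi (0 : ℝ), Real.exp (-(x * t)) * h t : ℝ) : ℂ) := by
    rw [← integral_complex_ofReal]
    push_cast
    rfl
  have haeval : aeval (x : ℂ) B = ((B.eval x : ℝ) : ℂ) := by
    rw [← Complex.coe_algebraMap, aeval_algebraMap_apply, coe_aeval_eq_eval]
  simp only [hreal, haeval] at hint
  have hB : ((B.eval x : ℝ) : ℂ) ≠ 0 := Complex.ofReal_ne_zero.2 hxB
  change (D.eval (x : ℂ)).im = 0
  by_cases hD : D.eval (x : ℂ) = 0
  · rw [hD, Complex.zero_im]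
  · have hI : ((∫ t in Set.Ioi (0 : ℝ), Real.exp (-(x * t)) * h t : ℝ) : ℂ) ≠ 0 := by
      rw [hint]
      exact div_ne_zero hB hD
    rw [eq_div_iff hD, mul_comm, ← eq_div_iff hI, ← Complex.ofReal_div] at hint
    rw [hint, Complex.ofReal_im]

theorem mainTheorem1 (m n : ℕ) (hmn : m < n) (K : ℝ) (hK : 0 < K) (z : Fin m → ℂ)
    (B : ℝ[X]) (hB : B.map (algebraMap ℝ ℂ) = C (K : ℂ) * ∏ i, (X - C (z i))) :
    StablePIRFeasible n K z ↔
      ∀ x : ℝ, 0 ≤ x → ¬ (transformedNumerator n B).IsRoot x := by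
  have hK0 : (K : ℂ) ≠ 0 := Complex.ofReal_ne_zero.2 hK.ne'
  have hBm : B.natDegree = m := by
    rw [← natDegree_map (algebraMap ℝ ℂ), hB, natDegree_C_mul hK0,
      natDegree_finsetProd_X_sub_C_eq_card, Finset.card_univ, Fintype.card_fin]
  have hBn : B.natDegree < n := hBm.trans_lt hmn
  have hlead : B.leadingCoeff = K := by
    apply Complex.ofReal_injective
    rw [← Complex.coe_algebraMap, ← leadingCoeff_map (algebraMap ℝ ℂ), hB, leadingCoeff_mul,
      leadingCoeff_C, (monic_prod_X_sub_C z Finset.univ).leadingCoeff, mul_one,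
      Complex.coe_algebraMap]
  have hB0 : B ≠ 0 := by
    rw [← leadingCoeff_ne_zero, hlead]
    exact hK.ne'
  constructor
  · rintro ⟨p, hp, h, ⟨hcont, c, hL⟩, hnn⟩
    have hLD : HasLaplace c h fun s => aeval s B / (∏ i, (X - C (p i))).eval s :=
      HasLaplace.congr hL (fun _ _ => rfl) fun s _ => closedLoopTransfer_eq_div hB p s
    obtain ⟨P, hP⟩ := exists_real_denominator hB0 hLD
    have haeval : ∀ s : ℂ, aeval s P = (∏ i, (X - C (p i))).eval s := fun s => by
      rw [← hP, eval_map, aeval_def]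
    have hroot : ∀ s : ℂ, aeval s P = 0 → s.re < 0 := by
      intro s hs
      rw [haeval, eval_prod, Finset.prod_eq_zero_iff] at hs
      obtain ⟨i, -, hi⟩ := hs
      rw [eval_sub, eval_X, eval_C, sub_eq_zero] at hi
      exact hi ▸ hp i
    have hmonic : P.Monic := by
      refine monic_of_injective (algebraMap ℝ ℂ).injective ?_
      rw [hP]
      exact monic_prod_X_sub_C p Finset.univ
    have hPn : P.natDegree = n := by
      rw [← natDegree_map (algebraMap ℝ ℂ), hP, natDegree_finsetProd_X_sub_C_eq_card,
        Finset.card_univ, Fintype.card_fin]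
    have hP0 : P.coeff 0 ≠ 0 := by
      intro h0
      have := hroot 0 (by rw [← coeff_zero_eq_aeval_zero', h0, map_zero])
      simp at this
    -- `h` is unconstrained on the negative axis, so it is replaced by a globally continuous function.
    refine not_isRoot_transformedNumerator hB0 hBn hPn (c := max c 0) (h := fun t => h (max t 0))
      (le_max_right _ _) (fun s hs h0 => ?_)
      (fun k => hmonic.coeff_nonneg_of_re_root_nonpos (fun w hw => (hroot w hw).le) k) hP0
      (hcont.comp_continuous (by fun_prop) fun t => le_max_right t 0)
      (fun t _ => hnn _ (le_max_right t 0))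
      ((hLD.mono (le_max_left c 0)).congr (fun t ht => by rw [max_eq_left ht])
        fun s _ => by rw [haeval])
    exact absurd (hroot s h0) (not_lt.2 ((le_max_right c 0).trans hs.le))
  · intro h
    obtain ⟨ε, hε, hnn⟩ := exists_pos_impulsePoly_taylor_nonneg hBn (hlead.symm ▸ hK)
      fun x hx => transformedNumerator_eval_pos hBn (hlead.symm ▸ hK) h hx
    have hdeg : (taylor (-ε) B).natDegree < n := by rwa [natDegree_taylor]
    refine ⟨fun _ => (-ε : ℝ), fun _ => by simpa using hε,
      fun t => Real.exp (-(ε * t)) * (impulsePoly n (taylor (-ε) B)).eval t,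
      ⟨Continuous.continuousOn (by fun_prop), 0 - ε, ?_⟩,
      fun t ht => mul_nonneg (Real.exp_pos _).le (hnn t ht)⟩
    refine ((hasLaplace_impulsePoly hdeg).exp_mul ε).congr (fun _ _ => rfl) fun s _ => ?_
    have hshift : aeval (s + ε) (taylor (-ε) B) = aeval s B := by
      rw [taylor_apply, aeval_comp]
      simp
    rw [closedLoopTransfer_eq_div hB, hshift]
    simp
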